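/- Let $(X,\varphi)$ be a Smale space: a homeomorphism of a compact metric space with a bracket $[\cdot,\cdot]$, defined and continuous on $\{d(x,y)\le\varepsilon_X\}$, satisfying the usual axioms ($[x,x]=x$, $[x,[y,z]]=[x,z]$, $[[x,y],z]=[x,z]$, $\varphi[x,y]=[\varphi x,\varphi y]$ whenever both sides are defined; $\varphi$ contracts by a factor $\lambda<1$ the distance of $y,z$ with $[y,z]=z$, and $\varphi^{-1}$ that of $y,z$ with $[y,z]=y$). Let $\pi=(Y,\psi,\pi_s,Z,\zeta,\pi_u)$ be an $s/u$-bijective pair for $(X,\varphi)$: $(Y,\psi)$ and $(Z,\zeta)$ are Smale spaces, $\pi_s\colon Y\to X$ and $\pi_u\colon Z\to X$ are continuous equivariant surjections, $\pi_s$ maps each global stable set $Y^s(y)$ bijectively onto $X^s(\pi_s(y))$, $\pi_u$ maps each global unstable set $Z^u(z)$ bijectively onto $X^u(\pi_u(z))$, and all the sets $Y^u(y)$ and $Z^s(z)$ are totally disconnected. For $L,M\ge 0$ let $$\Sigma_{L,M}=\{(y_0,\dots,y_L,z_0,\dots,z_M) : y_l\in Y,\ z_m\in Z,\ \pi_s(y_l)=\pi_u(z_m)\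 \text{for all } l,m\},$$ with the coordinatewise dynamics $\sigma$ and bracket. For $\Sigma=\Sigma_{L,M}$, let $CO^s(\Sigma)$ be the family of compact open subsets of the stable orbits $\Sigma^s(e)$, $e\in\Sigma$ (each orbit with the topology whose neighbourhood bases are the local stable sets), and let $\sim$ be the smallest equivalence relation on $CO^s(\Sigma)$ such that $E\sim F$ whenever $E$ and $F$ lie in local stable sets, $[E,F]$ and $[F,E]$ are defined, $[E,F]=E$ and $[F,E]=F$, and such that $E\sim F$ if and only if $\sigma(E)\sim\sigma(F)$. The dimension group $D^s(\Sigma)$ is the free abelian group on the classes $[E]$ modulo the subgroup generated by all $[E\cup F]-[E]-[F]$ with $E,F,E\cup F\in CO^s(\Sigma)$ and $E\cap F=\emptyset$. Put $C_{L,M}=D^s(\Sigma_{L,M})$. The symmetric group $S_{L+1}$ acts on $\Sigma_{L,M}$ by permuting $y_0,\dots,y_L$, hence on $C_{L,M}$. For $0\le l<p\le L+1$ the degeneracy $$d_{l,p}\colon\Sigma_{L,M}\to\Sigma_{L+1,M},\qquad (y_0,\dots,y_L,z)\mapsto(y_0,\dots,y_{p-1},y_l,y_p,\dots,y_L,z)$$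 induces $d_{l,p}^s\colon C_{L,M}\to C_{L+1,M}$, $[E]\mapsto[d_{l,p}(E)]$. Let $DC_{L,M}\subseteq C_{L,M}$ be the subgroup generated by the images of all the maps $d^s_{l,p}\colon C_{L-1,M}\to C_{L,M}$ (there are none if $L=0$) and by all $\alpha(a)-\operatorname{sgn}(\alpha)a$ with $a\in C_{L,M}$, $\alpha\in S_{L+1}$. Let $D^s_{\mathcal B}(\Sigma_{L,M})\subseteq C_{L,M}$ be the subgroup generated by all $a$ with $\alpha(a)=a$ for some transposition $\alpha\in S_{L+1}$ and by all $a-\operatorname{sgn}(\alpha)\alpha(a)$ with $a\in C_{L,M}$, $\alpha\in S_{L+1}$, and let $(C_{\mathcal Q})_{L,M}=D^s(\Sigma_{L,M})/D^s_{\mathcal B}(\Sigma_{L,M})$. **Proposition.** Suppose that $\pi_s$ is finite-to-one. Then the cardinalities of the fibers of $\pi_s$ have a maximum $K$ (taken to be $0$ if $X=\emptyset$), and with $N=K+1$, for all $L\ge N$ and all $M\ge 0$: 1. every generator $[E]$ of $D^s(\Sigma_{L,M})$, $E\in CO^s(\Sigma_{L,M})$, is degenerate: $[E]=d^s_{l,p}[F]$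 for some $0\le l<p\le L$ and some $F\in CO^s(\Sigma_{L-1,M})$; 2. $C_{L,M}=DC_{L,M}$; 3. $(C_{\mathcal Q})_{L,M}=0$. -/

import Mathlib

open Set Filter Topology

noncomputable section

/-! ### Dynamical systems with a partially defined bracket -/

/-- A homeomorphism of a metric space with a partially defined bracket operation:
`IsBracket x y z` says that `[x, y]` is defined and equal to `z`. -/
structure BracketSystem (T : Type*) [MetricSpace T] where
  /-- the dynamics -/
  φ : T ≃ₜ T
  /-- the graph of the bracket -/
  IsBracket : T → T → T → Prop
  unique : ∀ {x y z z' : T}, IsBracket x y z → IsBracket x y z' → z = z'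

/-- The topology in which `U` is open iff around each `y ∈ U` it contains all the `z` which are
close to `y` and satisfy `loc y z`. -/
abbrev leafTopology {T : Type*} [MetricSpace T] (loc : T → T → Prop) : TopologicalSpace T where
  IsOpen U := ∀ y ∈ U, ∃ δ > 0, ∀ z, dist y z < δ → loc y z → z ∈ U
  isOpen_univ := fun _ _ => ⟨1, one_pos, fun _ _ _ => mem_univ _⟩
  isOpen_inter := fun U V hU hV y hy => by
    obtain ⟨a, ha, h1⟩ := hU y hy.1
    obtain ⟨b, hb, h2⟩ := hV y hy.2
    exact ⟨min a b, lt_min ha hb, fun z hz hl =>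
      ⟨h1 z (hz.trans_le (min_le_left _ _)) hl, h2 z (hz.trans_le (min_le_right _ _)) hl⟩⟩
  isOpen_sUnion := fun 𝒰 h𝒰 y hy => by
    obtain ⟨U, hU, hyU⟩ := hy
    obtain ⟨a, ha, h1⟩ := h𝒰 U hU y hyU
    exact ⟨a, ha, fun z hz hl => ⟨U, hU, h1 z hz hl⟩⟩

namespace BracketSystem

variable {T : Type*} [MetricSpace T] (S : BracketSystem T)

/-- Stable equivalence. -/
def StablyEquiv (x y : T) : Prop :=
  Tendsto (fun n : ℕ => dist (S.φ^[n] x) (S.φ^[n] y)) atTop (𝓝 0)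

/-- Unstable equivalence. -/
def UnstablyEquiv (x y : T) : Prop :=
  Tendsto (fun n : ℕ => dist (S.φ.symm^[n] x) (S.φ.symm^[n] y)) atTop (𝓝 0)

/-- The global stable set (stable orbit) of `x`. -/
def stableSet (x : T) : Set T := {y | S.StablyEquiv x y}

/-- The global unstable set of `x`. -/
def unstableSet (x : T) : Set T := {y | S.UnstablyEquiv x y}

/-- The topology of the stable orbits, all at once (each stable orbit of a Smale space is open in
it): the local stable sets `{z | d(y, z) < δ, [y, z] = z}` form a neighbourhood base at `y`. -/
abbrev stableTopology : TopologicalSpace T := leafTopology fun y z => S.IsBracket y z z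

/-- The topology of the unstable orbits, all at once: the local unstable sets
`{z | d(y, z) < δ, [z, y] = z}` form a neighbourhood base at `y`. -/
abbrev unstableTopology : TopologicalSpace T := leafTopology fun y z => S.IsBracket z y z

/-- `E` is a compact open subset of some stable orbit. -/
def IsCO (E : Set T) : Prop :=
  (∃ e, E ⊆ S.stableSet e) ∧ @IsCompact T S.stableTopology E ∧ @IsOpen T S.stableTopology E

/-- The compact open subsets of the stable orbits. -/
def CO : Type _ := {E : Set T // S.IsCO E}

/-- `E` lies in a local stable set (around each of its points). -/
def IsLocal (E : Set T) : Prop := ∀ e ∈ E, ∀ e' ∈ E, S.IsBracket e e' e'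

/-- `[e, f]` is defined for all `e ∈ E` and `f ∈ F`. -/
def BracketDefined (E F : Set T) : Prop := ∀ e ∈ E, ∀ f ∈ F, ∃ g, S.IsBracket e f g

/-- `[E, F] = {[e, f] | e ∈ E, f ∈ F}`. -/
def bracketSet (E F : Set T) : Set T := {g | ∃ e ∈ E, ∃ f ∈ F, S.IsBracket e f g}

/-- The smallest equivalence relation `∼` on compact open sets such that `E ∼ F` if `E` and `F`
lie in local stable sets, `[E, F]` and `[F, E]` are defined, `[E, F] = E` and `[F, E] = F`,
and such that `E ∼ F` if and only if `φ(E) ∼ φ(F)`. -/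
inductive Rel : S.CO → S.CO → Prop
  | base (E F : S.CO) : S.IsLocal E.1 → S.IsLocal F.1 →
      S.BracketDefined E.1 F.1 → S.BracketDefined F.1 E.1 →
      S.bracketSet E.1 F.1 = E.1 → S.bracketSet F.1 E.1 = F.1 → Rel E F
  | shift (E F E' F' : S.CO) : E'.1 = S.φ '' E.1 → F'.1 = S.φ '' F.1 → Rel E F → Rel E' F'
  | unshift (E F E' F' : S.CO) : E'.1 = S.φ '' E.1 → F'.1 = S.φ '' F.1 → Rel E' F' → Rel E F
  | refl (E : S.CO) : Rel E E
  | symm (E F : S.CO) : Rel E F → Rel F E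
  | trans (E F G : S.CO) : Rel E F → Rel F G → Rel E G

/-- The relation `∼` as a setoid. -/
def relSetoid : Setoid S.CO := ⟨S.Rel, Rel.refl, fun h => Rel.symm _ _ h, Rel.trans _ _ _⟩

/-- The `∼`-equivalence class of a compact open set. -/
def cls (E : S.CO) : Quotient S.relSetoid := Quotient.mk _ E

/-- The subgroup generated by `[E ∪ F] - [E] - [F]` with `E`, `F` disjoint. -/
def additivity : AddSubgroup (FreeAbelianGroup (Quotient S.relSetoid)) :=
  AddSubgroup.closure {a | ∃ E F G : S.CO, Disjoint E.1 F.1 ∧ G.1 = E.1 ∪ F.1 ∧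
    a = FreeAbelianGroup.of (S.cls G) - FreeAbelianGroup.of (S.cls E)
      - FreeAbelianGroup.of (S.cls F)}

/-- The (stable) dimension group. -/
abbrev Ds : Type _ := FreeAbelianGroup (Quotient S.relSetoid) ⧸ S.additivity

/-- The generator `[E]` of the dimension group. -/
def gen (E : S.CO) : S.Ds := QuotientAddGroup.mk (FreeAbelianGroup.of (S.cls E))

/-- An equivariant map compatible with the brackets which is bijective on stable orbits and
carries compact open sets to compact open sets. -/
structure StableMap {T' : Type*} [MetricSpace T'] (S' : BracketSystem T') (f : T → T') :
    Prop where
  equivariant : ∀ x, f (S.φ x) = S'.φ (f x)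
  bracket : ∀ x y z, S.IsBracket x y z → S'.IsBracket (f x) (f y) (f z)
  bijOn : ∀ x, BijOn f (S.stableSet x) (S'.stableSet (f x))
  isCO : ∀ E, S.IsCO E → S'.IsCO (f '' E)

namespace StableMap

variable {S} {T' : Type*} [MetricSpace T'] {S' : BracketSystem T'} {f : T → T'}

/-- `E ↦ f(E)`. -/
def image (hf : S.StableMap S' f) (E : S.CO) : S'.CO := ⟨f '' E.1, hf.isCO E.1 E.2⟩

theorem rel_image (hf : S.StableMap S' f) {E F : S.CO} (h : S.Rel E F) :
    S'.Rel (hf.image E) (hf.image F) := by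
  have hl : ∀ E : Set T, S.IsLocal E → S'.IsLocal (f '' E) := by
    rintro E hE _ ⟨e, he, rfl⟩ _ ⟨e', he', rfl⟩
    exact hf.bracket _ _ _ (hE e he e' he')
  have hd : ∀ E F : Set T, S.BracketDefined E F → S'.BracketDefined (f '' E) (f '' F) := by
    rintro E F h _ ⟨e, he, rfl⟩ _ ⟨g, hg, rfl⟩
    obtain ⟨k, hk⟩ := h e he g hg
    exact ⟨f k, hf.bracket _ _ _ hk⟩
  have hb : ∀ E F : Set T, S.BracketDefined E F → S.bracketSet E F = E →
      S'.bracketSet (f '' E) (f '' F) = f '' E := by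
    intro E F h hE
    ext w
    constructor
    · rintro ⟨_, ⟨e, he, rfl⟩, _, ⟨g, hg, rfl⟩, hw⟩
      obtain ⟨k, hk⟩ := h e he g hg
      refine ⟨k, ?_, S'.unique (hf.bracket _ _ _ hk) hw⟩
      rw [← hE]
      exact ⟨e, he, g, hg, hk⟩
    · rintro ⟨k, hk, rfl⟩
      rw [← hE] at hk
      obtain ⟨e, he, g, hg, hk⟩ := hk
      exact ⟨_, ⟨e, he, rfl⟩, _, ⟨g, hg, rfl⟩, hf.bracket _ _ _ hk⟩
  have hs : ∀ E E' : S.CO, E'.1 = S.φ '' E.1 → (hf.image E').1 = S'.φ '' (hf.image E).1 := by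
    intro E E' h
    simp only [image, h, image_image, hf.equivariant]
  induction h with
  | base E F h1 h2 h3 h4 h5 h6 =>
    exact Rel.base _ _ (hl _ h1) (hl _ h2) (hd _ _ h3) (hd _ _ h4) (hb _ _ h3 h5) (hb _ _ h4 h6)
  | shift E F E' F' h1 h2 _ ih => exact Rel.shift _ _ _ _ (hs _ _ h1) (hs _ _ h2) ih
  | unshift E F E' F' h1 h2 _ ih => exact Rel.unshift _ _ _ _ (hs _ _ h1) (hs _ _ h2) ih
  | refl E => exact Rel.refl _
  | symm E F _ ih => exact Rel.symm _ _ ih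
  | trans E F G _ _ ih1 ih2 => exact Rel.trans _ _ _ ih1 ih2

/-- `[E] ↦ [f(E)]` on `∼`-equivalence classes. -/
def clsMap (hf : S.StableMap S' f) : Quotient S.relSetoid → Quotient S'.relSetoid :=
  Quotient.map' hf.image fun _ _ h => hf.rel_image h

theorem additivity_le (hf : S.StableMap S' f) :
    S.additivity ≤ S'.additivity.comap (FreeAbelianGroup.map hf.clsMap) := by
  refine (AddSubgroup.closure_le _).2 ?_
  rintro _ ⟨E, F, G, hd, hG, rfl⟩
  refine AddSubgroup.subset_closure ⟨hf.image E, hf.image F, hf.image G, ?_, ?_, ?_⟩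
  · obtain ⟨x, hx⟩ := G.2.1
    have hE : E.1 ⊆ S.stableSet x := (hG ▸ subset_union_left : E.1 ⊆ G.1).trans hx
    have hF : F.1 ⊆ S.stableSet x := (hG ▸ subset_union_right : F.1 ⊆ G.1).trans hx
    rw [Set.disjoint_left] at hd ⊢
    rintro _ ⟨a, ha, rfl⟩ ⟨b, hb, hab⟩
    have := (hf.bijOn x).injOn (hF hb) (hE ha) hab
    exact hd ha (this ▸ hb)
  · simp only [image, hG, image_union]
  · simp only [map_sub, FreeAbelianGroup.map_of_apply]
    rfl

/-- The induced homomorphism `f^s` of dimension groups, `[E] ↦ [f(E)]`. -/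
def dsMap (hf : S.StableMap S' f) : S.Ds →+ S'.Ds :=
  QuotientAddGroup.map S.additivity S'.additivity (FreeAbelianGroup.map hf.clsMap)
    hf.additivity_le

theorem dsMap_gen (hf : S.StableMap S' f) (E : S.CO) :
    hf.dsMap (S.gen E) = S'.gen (hf.image E) := by
  simp only [dsMap, gen, QuotientAddGroup.map_mk, FreeAbelianGroup.map_of_apply]
  rfl

end StableMap

end BracketSystem

/-! ### Smale spaces and s/u-bijective pairs -/

/-- A Smale space structure on a compact metric space. The bracket `[x, y]` is only meaningful
for `d(x, y) ≤ ε`; the algebraic axioms hold whenever both sides are defined. -/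
structure SmaleSpace (X : Type*) [MetricSpace X] [CompactSpace X] where
  /-- the dynamics -/
  φ : X ≃ₜ X
  /-- the bracket -/
  br : X → X → X
  /-- the size of the domain of the bracket -/
  ε : ℝ
  /-- the contraction constant -/
  lam : ℝ
  ε_pos : 0 < ε
  lam_pos : 0 < lam
  lam_lt_one : lam < 1
  br_continuous : ContinuousOn (fun p : X × X => br p.1 p.2) {p | dist p.1 p.2 ≤ ε}
  br_self : ∀ x, br x x = x
  br_br_right : ∀ x y z, dist y z ≤ ε → dist x (br y z) ≤ ε → dist x z ≤ ε →
    br x (br y z) = br x z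
  br_br_left : ∀ x y z, dist x y ≤ ε → dist (br x y) z ≤ ε → dist x z ≤ ε →
    br (br x y) z = br x z
  br_map : ∀ x y, dist x y ≤ ε → dist (φ x) (φ y) ≤ ε → φ (br x y) = br (φ x) (φ y)
  contract : ∀ y z, dist y z ≤ ε → br y z = z → dist (φ y) (φ z) ≤ lam * dist y z
  contract_symm : ∀ y z, dist y z ≤ ε → br y z = y →
    dist (φ.symm y) (φ.symm z) ≤ lam * dist y z

namespace SmaleSpace

variable {X : Type*} [MetricSpace X] [CompactSpace X]

/-- The underlying system with partially defined bracket. -/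
def sys (S : SmaleSpace X) : BracketSystem X where
  φ := S.φ
  IsBracket x y z := dist x y ≤ S.ε ∧ S.br x y = z
  unique h h' := h.2.symm.trans h'.2

theorem stablyEquiv_of_isBracket (S : SmaleSpace X) {y z : X} (h : S.sys.IsBracket y z z) :
    S.sys.StablyEquiv y z := by
  have key : ∀ n : ℕ, dist (S.φ^[n] y) (S.φ^[n] z) ≤ S.lam ^ n * dist y z ∧
      dist (S.φ^[n] y) (S.φ^[n] z) ≤ S.ε ∧ S.br (S.φ^[n] y) (S.φ^[n] z) = S.φ^[n] z := by
    intro n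
    induction n with
    | zero => exact ⟨by simp, h.1, h.2⟩
    | succ n ih =>
      obtain ⟨h1, h2, h3⟩ := ih
      simp only [Function.iterate_succ_apply']
      have h4 := S.contract _ _ h2 h3
      have h5 : dist (S.φ (S.φ^[n] y)) (S.φ (S.φ^[n] z)) ≤ S.ε :=
        h4.trans ((mul_le_of_le_one_left dist_nonneg S.lam_lt_one.le).trans h2)
      refine ⟨h4.trans ?_, h5, ?_⟩
      · rw [pow_succ', mul_assoc]
        exact mul_le_mul_of_nonneg_left h1 S.lam_pos.le
      · rw [← S.br_map _ _ h2 h5, h3]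
  refine squeeze_zero (fun _ => dist_nonneg) (fun n => (key n).1) ?_
  simpa using (tendsto_pow_atTop_nhds_zero_of_lt_one S.lam_pos.le S.lam_lt_one).mul_const
    (dist y z)

end SmaleSpace

/-- An s/u-bijective pair for a Smale space `X`: Smale spaces `Y`, `Z` with factor maps
`πs : Y → X`, `πu : Z → X` such that `πs` is s-bijective and the unstable sets of `Y` are totally
disconnected, while `πu` is u-bijective and the stable sets of `Z` are totally disconnected. -/
structure SUBijectivePair {X Y Z : Type*} [MetricSpace X] [CompactSpace X] [MetricSpace Y]
    [CompactSpace Y] [MetricSpace Z] [CompactSpace Z]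
    (SX : SmaleSpace X) (SY : SmaleSpace Y) (SZ : SmaleSpace Z) where
  /-- the s-bijective factor map -/
  πs : Y → X
  /-- the u-bijective factor map -/
  πu : Z → X
  πs_continuous : Continuous πs
  πs_surjective : Function.Surjective πs
  πs_map : ∀ y, πs (SY.φ y) = SX.φ (πs y)
  πs_bijOn : ∀ y, BijOn πs (SY.sys.stableSet y) (SX.sys.stableSet (πs y))
  Y_disconnected : ∀ y, @IsTotallyDisconnected Y SY.sys.unstableTopology (SY.sys.unstableSet y)
  πu_continuous : Continuous πu
  πu_surjective : Function.Surjective πu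
  πu_map : ∀ z, πu (SZ.φ z) = SX.φ (πu z)
  πu_bijOn : ∀ z, BijOn πu (SZ.sys.unstableSet z) (SX.sys.unstableSet (πu z))
  Z_disconnected : ∀ z, @IsTotallyDisconnected Z SZ.sys.stableTopology (SZ.sys.stableSet z)

namespace SUBijectivePair

variable {X Y Z : Type*} [MetricSpace X] [CompactSpace X] [MetricSpace Y]
  [CompactSpace Y] [MetricSpace Z] [CompactSpace Z]
  {SX : SmaleSpace X} {SY : SmaleSpace Y} {SZ : SmaleSpace Z} (π : SUBijectivePair SX SY SZ)

/-! ### The systems `Σ_{L,M}` -/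

/-- The space `Σ_{L,M}` of tuples `(y_0, …, y_L, z_0, …, z_M)` with `πs(y_l) = πu(z_m)`, with the
maximum metric. -/
abbrev Space (L M : ℕ) : Type _ :=
  {w : (Fin (L + 1) → Y) × (Fin (M + 1) → Z) // ∀ l m, π.πs (w.1 l) = π.πu (w.2 m)}

/-- `Σ_{L,M}` with the coordinatewise dynamics and the coordinatewise bracket. -/
def sys (L M : ℕ) : BracketSystem (π.Space L M) where
  φ := Homeomorph.subtype
    ((Homeomorph.piCongrRight fun _ => SY.φ).prodCongr (Homeomorph.piCongrRight fun _ => SZ.φ))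
    (by
      intro w
      change _ ↔ ∀ l m, π.πs (SY.φ (w.1 l)) = π.πu (SZ.φ (w.2 m))
      simp only [π.πs_map, π.πu_map, SX.φ.injective.eq_iff])
  IsBracket v w u := (∀ l, SY.sys.IsBracket (v.1.1 l) (w.1.1 l) (u.1.1 l)) ∧
    ∀ m, SZ.sys.IsBracket (v.1.2 m) (w.1.2 m) (u.1.2 m)
  unique h h' := Subtype.ext (Prod.ext (funext fun l => SY.sys.unique (h.1 l) (h'.1 l))
    (funext fun m => SZ.sys.unique (h.2 m) (h'.2 m)))

/-- The reindexing map `(y, z) ↦ (y ∘ g, z)`. -/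
def reindex {L L' : ℕ} (M : ℕ) (g : Fin (L' + 1) → Fin (L + 1)) (w : π.Space L M) :
    π.Space L' M :=
  ⟨(w.1.1 ∘ g, w.1.2), fun l m => w.2 (g l) m⟩

theorem dist_reindex_le {L L' M : ℕ} (g : Fin (L' + 1) → Fin (L + 1)) (v w : π.Space L M) :
    dist (π.reindex M g v) (π.reindex M g w) ≤ dist v w := by
  rw [Subtype.dist_eq, Subtype.dist_eq, Prod.dist_eq, Prod.dist_eq]
  refine max_le_max ?_ le_rfl
  exact (dist_pi_le_iff dist_nonneg).2 fun l => dist_le_pi_dist v.1.1 w.1.1 (g l)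

theorem reindex_iterate {L L' M : ℕ} (g : Fin (L' + 1) → Fin (L + 1)) (n : ℕ)
    (w : π.Space L M) :
    π.reindex M g ((π.sys L M).φ^[n] w) = (π.sys L' M).φ^[n] (π.reindex M g w) := by
  induction n with
  | zero => rfl
  | succ n ih =>
    simp only [Function.iterate_succ_apply']
    rw [← ih]
    rfl

theorem stablyEquiv_reindex {L L' M : ℕ} (g : Fin (L' + 1) → Fin (L + 1)) {v w : π.Space L M}
    (h : (π.sys L M).StablyEquiv v w) :
    (π.sys L' M).StablyEquiv (π.reindex M g v) (π.reindex M g w) := by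
  refine squeeze_zero (fun _ => dist_nonneg) (fun n => ?_) h
  rw [← reindex_iterate, ← reindex_iterate]
  exact π.dist_reindex_le g _ _

theorem isBracket_reindex {L L' M : ℕ} (g : Fin (L' + 1) → Fin (L + 1)) {u v w : π.Space L M}
    (h : (π.sys L M).IsBracket u v w) :
    (π.sys L' M).IsBracket (π.reindex M g u) (π.reindex M g v) (π.reindex M g w) :=
  ⟨fun l => h.1 (g l), h.2⟩

theorem iterate_coord {L M : ℕ} (n : ℕ) (w : π.Space L M) (l : Fin (L + 1)) :
    ((π.sys L M).φ^[n] w).1.1 l = SY.φ^[n] (w.1.1 l) := by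
  induction n with
  | zero => rfl
  | succ n ih =>
    simp only [Function.iterate_succ_apply']
    rw [← ih]
    rfl

theorem stablyEquiv_coord {L M : ℕ} {v w : π.Space L M} (h : (π.sys L M).StablyEquiv v w)
    (l : Fin (L + 1)) : SY.sys.StablyEquiv (v.1.1 l) (w.1.1 l) := by
  refine squeeze_zero (fun _ => dist_nonneg) (fun n => ?_) h
  change dist (SY.φ^[n] (v.1.1 l)) (SY.φ^[n] (w.1.1 l)) ≤ _
  rw [← iterate_coord, ← iterate_coord, Subtype.dist_eq, Prod.dist_eq]
  exact (dist_le_pi_dist _ _ l).trans (le_max_left _ _)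

theorem coord_eq {L M : ℕ} {v w : π.Space L M} {l l' : Fin (L + 1)}
    (hl : SY.sys.StablyEquiv (v.1.1 l) (w.1.1 l))
    (hl' : SY.sys.StablyEquiv (v.1.1 l') (w.1.1 l')) (h : v.1.1 l = v.1.1 l') :
    w.1.1 l = w.1.1 l' := by
  rw [← h] at hl'
  exact (π.πs_bijOn (v.1.1 l)).injOn hl hl' ((w.2 l 0).trans (w.2 l' 0).symm)

theorem continuous_reindex {L L' M : ℕ} (g : Fin (L' + 1) → Fin (L + 1)) :
    @Continuous _ _ (π.sys L M).stableTopology (π.sys L' M).stableTopology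
      (π.reindex M g) := by
  refine @Continuous.mk _ _ (π.sys L M).stableTopology (π.sys L' M).stableTopology _ ?_
  intro U hU v hv
  obtain ⟨δ, hδ, h⟩ := hU _ hv
  exact ⟨δ, hδ, fun w hd hb =>
    h _ ((π.dist_reindex_le g v w).trans_lt hd) (π.isBracket_reindex g hb)⟩

theorem stableMap_reindex {L L' : ℕ} (M : ℕ) {g : Fin (L' + 1) → Fin (L + 1)}
    (hg : Function.Surjective g) :
    (π.sys L M).StableMap (π.sys L' M) (π.reindex M g) := by
  obtain ⟨h, hgh⟩ := hg.hasRightInverse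
  have hr : ∀ w : π.Space L M, π.reindex M h (π.reindex M g w) = w := fun w =>
    Subtype.ext (Prod.ext (funext fun l => congrArg w.1.1 (hgh l)) rfl)
  have hr' : ∀ (v : π.Space L M) (w : π.Space L' M),
      (∀ l, SY.sys.StablyEquiv ((π.reindex M g v).1.1 l) (w.1.1 l)) →
      π.reindex M g (π.reindex M h w) = w := fun v w hvw =>
    Subtype.ext (Prod.ext (funext fun l =>
      π.coord_eq (v := π.reindex M g v) (hvw _) (hvw l) (congrArg v.1.1 (hgh (g l)))) rfl)
  refine ⟨fun _ => rfl, fun _ _ _ => π.isBracket_reindex g, fun v => ⟨?_, ?_, ?_⟩, ?_⟩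
  · exact fun w hw => π.stablyEquiv_reindex g hw
  · intro a _ b _ hab
    rw [← hr a, hab, hr b]
  · intro w hw
    refine ⟨π.reindex M h w, ?_, hr' v w (π.stablyEquiv_coord hw)⟩
    have := π.stablyEquiv_reindex h hw
    rwa [hr] at this
  · rintro E ⟨⟨e, he⟩, hc, ho⟩
    refine ⟨⟨π.reindex M g e, ?_⟩, ?_, ?_⟩
    · rintro _ ⟨w, hw, rfl⟩
      exact π.stablyEquiv_reindex g (he hw)
    · exact @IsCompact.image _ _ (π.sys L M).stableTopology (π.sys L' M).stableTopology _ _ hc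
        (π.continuous_reindex g)
    · rintro _ ⟨v, hv, rfl⟩
      obtain ⟨δ, hδ, hU⟩ := ho v hv
      refine ⟨δ, hδ, fun w hd hb => ⟨π.reindex M h w, hU _ ?_ ?_, hr' v w fun l =>
        SY.stablyEquiv_of_isBracket (hb.1 l)⟩⟩
      · have := π.dist_reindex_le h (π.reindex M g v) w
        rw [hr] at this
        exact this.trans_lt hd
      · have := π.isBracket_reindex h hb
        rwa [hr] at this

/-! ### Chains, degenerate chains and the complex `C_Q` -/

/-- `C_{L,M} = D^s(Σ_{L,M})`. -/
abbrev C (L M : ℕ) : Type _ := (π.sys L M).Ds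

/-- The action of `α` in the symmetric group `S_{L+1}` on `C_{L,M}` induced by the
permutation `α(y)_{α(l)} = y_l` of the entries `y_0, …, y_L`. -/
def permMap (L M : ℕ) (α : Equiv.Perm (Fin (L + 1))) : π.C L M →+ π.C L M :=
  (π.stableMap_reindex M (g := α.symm) α.symm.surjective).dsMap

theorem insertNth_surjective {L : ℕ} (l : Fin (L + 1)) (p : Fin (L + 2)) :
    Function.Surjective (p.insertNth l id : Fin (L + 2) → Fin (L + 1)) :=
  fun i => ⟨p.succAbove i, by simp⟩

/-- The homomorphism `C_{L,M} → C_{L+1,M}` induced by the degeneracy which repeats the entry `y_l`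
at coordinate `p`,
`(y_0, …, y_L) ↦ (y_0, …, y_l, …, y_{p-1}, y_l, y_p, …, y_L)`.
For `p = l + j`, `j ≥ 1`, this is `(σ_j s_l)^s`. -/
def degMap (L M : ℕ) (l : Fin (L + 1)) (p : Fin (L + 2)) : π.C L M →+ π.C (L + 1) M :=
  (π.stableMap_reindex M (insertNth_surjective l p)).dsMap

/-- The sum of the images of all the degeneracies `(σ_j s_l)^s`; it is zero for `L = 0`. -/
def degImages : (L M : ℕ) → AddSubgroup (π.C L M)
  | 0, _ => ⊥
  | L + 1, M => ⨆ (l : Fin (L + 1)) (p : Fin (L + 2)) (_ : l.castSucc < p), (π.degMap L M l p).range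

/-- The group `DC_{L,M}` of degenerate chains. -/
def DC (L M : ℕ) : AddSubgroup (π.C L M) :=
  π.degImages L M ⊔ AddSubgroup.closure
    {b | ∃ (a : π.C L M) (α : Equiv.Perm (Fin (L + 1))),
      b = π.permMap L M α a - (Equiv.Perm.sign α : ℤ) • a}

/-- The subgroup `D^s_B(Σ_{L,M})`. -/
def DB (L M : ℕ) : AddSubgroup (π.C L M) :=
  AddSubgroup.closure
    ({a | ∃ α : Equiv.Perm (Fin (L + 1)), α.IsSwap ∧ π.permMap L M α a = a} ∪
     {b | ∃ (a : π.C L M) (α : Equiv.Perm (Fin (L + 1))),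
      b = a - (Equiv.Perm.sign α : ℤ) • π.permMap L M α a})

/-- `(C_Q)_{L,M} = D^s(Σ_{L,M}) / D^s_B(Σ_{L,M})`. -/
abbrev CQ (L M : ℕ) : Type _ := π.C L M ⧸ π.DB L M

end SUBijectivePair

end

/-!
If two points `y`, `y'` of a fiber of `πs` are close, then `[y, y']` is locally stably
equivalent to `y` and locally unstably equivalent to `y'`, so its image stays close to their
common image for all times. By expansiveness of `X` it lies in the same fiber, and by
injectivity of `πs` on stable sets it equals `y`; hence `y` and `y'` are locally unstably
equivalent. Points which are close in this way at arbitrarily late times coincide, so any finite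
subset of a fiber is eventually `δ`-separated with `δ` uniform, and the packing number of the
compact space `Y` bounds all fibers.

If `L + 1` exceeds the cardinality of the fibers, two coordinates of a given point of `Σ_{L,M}`
coincide, say the `i`-th and the `j`-th. Injectivity of `πs` on stable sets propagates this to
its whole stable orbit. A compact open subset `E` of this orbit therefore lies in the image of
the degeneracy which repeats the `i`-th coordinate at `j`, and `[E]` is fixed by the
transposition `(i j)`.
-/

namespace BracketSystem

variable {T T' : Type*} [MetricSpace T] [MetricSpace T'] (S : BracketSystem T)
  {S' : BracketSystem T'}

theorem self_mem_stableSet (x : T) : x ∈ S.stableSet x := by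
  simp [stableSet, StablyEquiv]

theorem eq_top_of_forall_gen_mem {H : AddSubgroup S.Ds} (h : ∀ E, S.gen E ∈ H) : H = ⊤ := by
  refine eq_top_iff.2 fun a _ => ?_
  obtain ⟨a, rfl⟩ := QuotientAddGroup.mk_surjective a
  induction a using FreeAbelianGroup.induction_on with
  | zero => exact zero_mem _
  | of q =>
    obtain ⟨E, rfl⟩ := Quotient.mk_surjective q
    exact h E
  | neg q hq => exact neg_mem (hq trivial)
  | add a b ha hb => exact add_mem (ha trivial) (hb trivial)

variable {S}

theorem IsCO.image_of_leftInvOn {E : Set T'} (hE : S'.IsCO E) {f : T → T'} {k : T' → T}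
    (hf : @Continuous _ _ S.stableTopology S'.stableTopology f)
    (hk : @Continuous _ _ S'.stableTopology S.stableTopology k)
    (hstable : ∀ v w, S'.StablyEquiv v w → S.StablyEquiv (k v) (k w))
    (hkf : Function.LeftInverse k f) (hfk : LeftInvOn f k E) : S.IsCO (k '' E) := by
  obtain ⟨⟨e, he⟩, hcompact, hopen⟩ := hE
  have himage : k '' E = f ⁻¹' E :=
    Subset.antisymm (image_subset_iff.2 fun w hw => by rwa [mem_preimage, mem_preimage, hfk hw])
      fun v hv => ⟨f v, hv, hkf v⟩
  refine ⟨⟨k e, image_subset_iff.2 fun w hw => hstable e w (he hw)⟩, ?_, ?_⟩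
  · exact @IsCompact.image _ _ S'.stableTopology S.stableTopology _ _ hcompact hk
  · rw [himage]
    exact @IsOpen.preimage _ _ S.stableTopology S'.stableTopology _ hf _ hopen

end BracketSystem

/-- Expansiveness of a homeomorphism: two orbits which stay `δ`-close for all times coincide.
Positive and negative times are separate hypotheses because the axioms of a Smale space control
them separately. -/
def IsExpansive {X : Type*} [MetricSpace X] (φ : X ≃ₜ X) : Prop :=
  ∃ δ > 0, ∀ x y : X, (∀ n : ℕ, dist (φ^[n] x) (φ^[n] y) ≤ δ) →
    (∀ n : ℕ, dist (φ.symm^[n] x) (φ.symm^[n] y) ≤ δ) → x = y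

namespace SmaleSpace

variable {X : Type*} [MetricSpace X] [CompactSpace X]

/-- The inverse Smale space: the dynamics is inverted and the bracket is flipped. It exchanges
stable and unstable sets, so every statement about the former yields one about the latter. -/
def symm (S : SmaleSpace X) : SmaleSpace X where
  φ := S.φ.symm
  br x y := S.br y x
  ε := S.ε
  lam := S.lam
  ε_pos := S.ε_pos
  lam_pos := S.lam_pos
  lam_lt_one := S.lam_lt_one
  br_continuous := S.br_continuous.comp continuous_swap.continuousOn fun p hp =>
    (dist_comm p.2 p.1).trans_le hp
  br_self := S.br_self
  br_br_right x y z h1 h2 h3 := by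
    rw [dist_comm] at h1 h2 h3
    exact S.br_br_left z y x h1 h2 h3
  br_br_left x y z h1 h2 h3 := by
    rw [dist_comm] at h1 h2 h3
    exact S.br_br_right z y x h1 h2 h3
  br_map x y h1 h2 := by
    rw [dist_comm] at h1 h2
    rw [Homeomorph.symm_apply_eq, S.br_map _ _ h2 (by simpa using h1)]
    simp
  contract y z h1 h2 := by
    rw [dist_comm] at h1
    simpa [dist_comm] using S.contract_symm z y h1 h2
  contract_symm y z h1 h2 := by
    rw [dist_comm] at h1
    simpa [dist_comm] using S.contract z y h1 h2

variable (S : SmaleSpace X)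

/-- `z` lies in the local stable set `X^s(y, ε)`. The local unstable sets are those of
`S.symm`. -/
def LocallyStable (y z : X) : Prop := dist y z ≤ S.ε ∧ S.br y z = z

variable {S}

theorem LocallyStable.map {y z : X} (h : S.LocallyStable y z) :
    S.LocallyStable (S.φ y) (S.φ z) := by
  have hd : dist (S.φ y) (S.φ z) ≤ S.ε :=
    (S.contract y z h.1 h.2).trans
      ((mul_le_of_le_one_left dist_nonneg S.lam_lt_one.le).trans h.1)
  exact ⟨hd, by rw [← S.br_map y z h.1 hd, h.2]⟩

theorem LocallyStable.iterate {y z : X} (h : S.LocallyStable y z) (n : ℕ) :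
    S.LocallyStable (S.φ^[n] y) (S.φ^[n] z) := by
  induction n with
  | zero => exact h
  | succ n ih => simpa only [Function.iterate_succ_apply'] using ih.map

theorem LocallyStable.dist_iterate_le {y z : X} (h : S.LocallyStable y z) (n : ℕ) :
    dist (S.φ^[n] y) (S.φ^[n] z) ≤ S.lam ^ n * dist y z := by
  induction n with
  | zero => simp
  | succ n ih =>
    simp only [Function.iterate_succ_apply']
    calc dist (S.φ (S.φ^[n] y)) (S.φ (S.φ^[n] z))
        ≤ S.lam * dist (S.φ^[n] y) (S.φ^[n] z) :=
          S.contract _ _ (h.iterate n).1 (h.iterate n).2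
      _ ≤ S.lam * (S.lam ^ n * dist y z) := by gcongr; exact S.lam_pos.le
      _ = S.lam ^ (n + 1) * dist y z := by ring

theorem LocallyStable.dist_iterate_le_dist {y z : X} (h : S.LocallyStable y z) (n : ℕ) :
    dist (S.φ^[n] y) (S.φ^[n] z) ≤ dist y z :=
  (h.dist_iterate_le n).trans
    (mul_le_of_le_one_left dist_nonneg (pow_le_one₀ S.lam_pos.le S.lam_lt_one.le))

theorem eq_of_frequently_locallyStable {y z : X}
    (h : ∃ᶠ n : ℕ in atTop, S.LocallyStable (S.φ.symm^[n] y) (S.φ.symm^[n] z)) : y = z := by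
  have hlim : Tendsto (fun n : ℕ => S.lam ^ n * S.ε) atTop (𝓝 0) := by
    simpa using
      (tendsto_pow_atTop_nhds_zero_of_lt_one S.lam_pos.le S.lam_lt_one).mul_const S.ε
  refine dist_le_zero.1 (ge_of_tendsto_of_frequently hlim (h.mono fun n hn => ?_))
  have hinv : Function.RightInverse S.φ.symm^[n] S.φ^[n] :=
    Function.RightInverse.iterate S.φ.apply_symm_apply n
  calc dist y z
      = dist (S.φ^[n] (S.φ.symm^[n] y)) (S.φ^[n] (S.φ.symm^[n] z)) := by rw [hinv y, hinv z]
    _ ≤ S.lam ^ n * dist (S.φ.symm^[n] y) (S.φ.symm^[n] z) := hn.dist_iterate_le n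
    _ ≤ S.lam ^ n * S.ε := mul_le_mul_of_nonneg_left hn.1 (pow_nonneg S.lam_pos.le n)

variable (S)

theorem exists_locallyStable_br {η : ℝ} (hη : 0 < η) :
    ∃ δ > 0, ∀ x y, dist x y ≤ δ → S.LocallyStable x (S.br x y) ∧ dist x (S.br x y) ≤ η := by
  have hclosed : IsClosed {p : X × X | dist p.1 p.2 ≤ S.ε} :=
    isClosed_le (continuous_fst.dist continuous_snd) continuous_const
  obtain ⟨δ, hδ, hbr⟩ := Metric.uniformContinuousOn_iff_le.1
    (hclosed.isCompact.uniformContinuousOn_of_continuous S.br_continuous)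
    (min η S.ε) (lt_min hη S.ε_pos)
  refine ⟨min δ S.ε, lt_min hδ S.ε_pos, fun x y hxy => ?_⟩
  obtain ⟨hxyδ, hxyε⟩ := le_min_iff.1 hxy
  have hdist : dist x (S.br x y) ≤ min η S.ε := by
    simpa only [S.br_self] using
      hbr (x, x) (by simp [S.ε_pos.le]) (x, y) hxyε (by simp [Prod.dist_eq, hxyδ])
  obtain ⟨hdistη, hdistε⟩ := le_min_iff.1 hdist
  exact ⟨⟨hdistε, S.br_br_right x x y hxyε hdistε hxyε⟩, hdistη⟩

theorem iterate_br {x y : X} (h : ∀ n : ℕ, dist (S.φ^[n] x) (S.φ^[n] y) ≤ S.ε) (n : ℕ) :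
    S.φ^[n] (S.br x y) = S.br (S.φ^[n] x) (S.φ^[n] y) := by
  induction n with
  | zero => rfl
  | succ n ih =>
    have hn := h (n + 1)
    simp only [Function.iterate_succ_apply'] at hn ⊢
    rw [ih, S.br_map _ _ (h n) hn]

theorem exists_locallyStable_of_forall_dist_iterate_le :
    ∃ δ > 0, ∀ x y, (∀ n : ℕ, dist (S.φ^[n] x) (S.φ^[n] y) ≤ δ) → S.LocallyStable x y := by
  obtain ⟨δ, hδ, hbr⟩ := S.symm.exists_locallyStable_br one_pos
  refine ⟨min δ S.ε, lt_min hδ S.ε_pos, fun x y h => ?_⟩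
  have hdδ n := (h n).trans (min_le_left _ _)
  have hdε n := (h n).trans (min_le_right _ _)
  -- `[x, y]` is locally unstably equivalent to `y` along the whole forward orbit.
  have hy : y = S.br x y :=
    S.symm.eq_of_frequently_locallyStable <| Frequently.of_forall fun n => by
      have hn : S.symm.LocallyStable (S.φ^[n] y) (S.br (S.φ^[n] x) (S.φ^[n] y)) :=
        (hbr _ _ (by rw [dist_comm]; exact hdδ n)).1
      rwa [← S.iterate_br hdε n] at hn
  exact ⟨hdε 0, hy.symm⟩

theorem isExpansive : IsExpansive S.φ := by
  obtain ⟨δ, hδ, hstable⟩ := S.exists_locallyStable_of_forall_dist_iterate_le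
  obtain ⟨δ', hδ', hunstable⟩ := S.symm.exists_locallyStable_of_forall_dist_iterate_le
  refine ⟨min δ δ', lt_min hδ hδ', fun x y hpos hneg => ?_⟩
  have hy : S.br x y = y := (hstable x y fun n => (hpos n).trans (min_le_left _ _)).2
  have hx : S.br x y = x := (hunstable y x fun n => by
    rw [dist_comm]
    exact (hneg n).trans (min_le_right _ _)).2
  exact hx.symm.trans hy

end SmaleSpace

section Packing

open Metric
open scoped NNReal

theorem packingNumber_ne_top {Y : Type*} [PseudoEMetricSpace Y] {A : Set Y}
    (hA : TotallyBounded A) {δ : ℝ≥0} (hδ : δ ≠ 0) : packingNumber δ A ≠ ⊤ := by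
  obtain ⟨C, -, hfinite, hcover⟩ :=
    exists_finite_isCover_of_totallyBounded (div_ne_zero hδ two_ne_zero) hA
  refine ne_top_of_le_ne_top hfinite.encard_lt_top.ne ?_
  calc packingNumber δ A = packingNumber (2 * (δ / 2)) A := by rw [mul_div_cancel₀ _ two_ne_zero]
    _ ≤ externalCoveringNumber (δ / 2) A := packingNumber_two_mul_le_externalCoveringNumber _ _
    _ ≤ C.encard := hcover.externalCoveringNumber_le_encard

theorem encard_le_packingNumber_univ {α ι Y : Type*} [PseudoEMetricSpace Y] {l : Filter ι}
    [l.NeBot] {s : Set α} {g : ι → α → Y} {δ : ℝ≥0}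
    (h : s.Pairwise fun a b => ∀ᶠ n in l, δ < edist (g n a) (g n b)) :
    s.encard ≤ packingNumber δ (univ : Set Y) := by
  have hfinite : ∀ t ⊆ s, t.Finite → t.encard ≤ packingNumber δ (univ : Set Y) := by
    intro t hts ht
    have hsep : ∀ᶠ n in l, t.Pairwise fun a b => δ < edist (g n a) (g n b) := by
      refine ht.eventually_all.2 fun a ha => ht.eventually_all.2 fun b hb => ?_
      exact eventually_imp_distrib_left.2 (h (hts ha) (hts hb))
    obtain ⟨n, hn⟩ := hsep.exists
    have hinj : InjOn (g n) t := fun a ha b hb hab => by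
      by_contra hne
      simpa [hab] using hn ha hb hne
    rw [← hinj.encard_image]
    exact IsSeparated.encard_le_packingNumber (subset_univ _) (hinj.pairwise_image.2 hn)
  rw [← ENat.forall_natCast_le_iff_le]
  intro k hk
  obtain ⟨t, hts, htk⟩ := exists_subset_encard_eq hk
  exact htk ▸ hfinite t hts (finite_of_encard_eq_coe htk)

end Packing

namespace SmaleSpace

variable {X Y : Type*} [MetricSpace X] [MetricSpace Y] [CompactSpace Y] {φ : X ≃ₜ X}
  (S : SmaleSpace Y) {f : Y → X}

theorem exists_locallyUnstable_of_map_eq (hφ : IsExpansive φ) (hf : Continuous f)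
    (hfφ : Function.Semiconj f S.φ φ) (hinj : ∀ y, InjOn f (S.sys.stableSet y)) :
    ∃ δ > 0, ∀ y y', f y = f y' → dist y y' ≤ δ → S.symm.LocallyStable y' y := by
  obtain ⟨c, hc, hexp⟩ := hφ
  obtain ⟨η, hη, hfη⟩ := Metric.uniformContinuous_iff_le.1
    (CompactSpace.uniformContinuous_of_continuous hf) c hc
  obtain ⟨δ, hδ, hstable⟩ := S.exists_locallyStable_br hη
  obtain ⟨δ', hδ', hunstable⟩ := S.symm.exists_locallyStable_br hη
  refine ⟨min δ δ', lt_min hδ hδ', fun y y' hyy' hd => ?_⟩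
  obtain ⟨hs, hsη⟩ := hstable y y' (hd.trans (min_le_left _ _))
  obtain ⟨hu, huη⟩ : S.symm.LocallyStable y' (S.br y y') ∧ dist y' (S.br y y') ≤ η :=
    hunstable y' y (by rw [dist_comm]; exact hd.trans (min_le_right _ _))
  have hfφ_symm : Function.Semiconj f S.φ.symm φ.symm := fun y => by
    rw [Homeomorph.eq_symm_apply, ← hfφ.eq, Homeomorph.apply_symm_apply]
  have hfbr : f y = f (S.br y y') := by
    refine hexp _ _ (fun n => ?_) fun n => ?_
    · rw [← (hfφ.iterate_right n).eq, ← (hfφ.iterate_right n).eq]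
      exact hfη ((hs.dist_iterate_le_dist n).trans hsη)
    · rw [hyy', ← (hfφ_symm.iterate_right n).eq, ← (hfφ_symm.iterate_right n).eq]
      exact hfη ((hu.dist_iterate_le_dist n).trans huη)
  have hbr : y = S.br y y' :=
    hinj y (S.sys.self_mem_stableSet y) (S.stablyEquiv_of_isBracket hs) hfbr
  rwa [← hbr] at hu

theorem exists_eventually_lt_dist_iterate (hφ : IsExpansive φ) (hf : Continuous f)
    (hfφ : Function.Semiconj f S.φ φ) (hinj : ∀ y, InjOn f (S.sys.stableSet y)) :
    ∃ δ > 0, ∀ y y', f y = f y' → y ≠ y' →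
      ∀ᶠ n : ℕ in atTop, δ < dist (S.φ^[n] y) (S.φ^[n] y') := by
  obtain ⟨δ, hδ, hunstable⟩ := S.exists_locallyUnstable_of_map_eq hφ hf hfφ hinj
  refine ⟨δ, hδ, fun y y' hyy' hne => ?_⟩
  by_contra hclose
  refine hne (S.symm.eq_of_frequently_locallyStable ?_).symm
  refine (not_eventually.1 hclose).mono fun n hn =>
    hunstable (S.φ^[n] y) (S.φ^[n] y') ?_ (not_lt.1 hn)
  rw [(hfφ.iterate_right n).eq, (hfφ.iterate_right n).eq, hyy']

theorem exists_forall_encard_fiber_le (hφ : IsExpansive φ) (hf : Continuous f)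
    (hfφ : Function.Semiconj f S.φ φ) (hinj : ∀ y, InjOn f (S.sys.stableSet y)) :
    ∃ N : ℕ, ∀ x, (f ⁻¹' {x}).encard ≤ N := by
  obtain ⟨δ, hδ, hsep⟩ := S.exists_eventually_lt_dist_iterate hφ hf hfφ hinj
  lift δ to NNReal using hδ.le
  have hN := packingNumber_ne_top (isCompact_univ (X := Y)).totallyBounded
    (NNReal.coe_pos.1 hδ).ne'
  refine ⟨(Metric.packingNumber δ (univ : Set Y)).toNat, fun x => ?_⟩
  rw [ENat.natCast_toNat hN]
  refine encard_le_packingNumber_univ (l := atTop) (g := fun n : ℕ => S.φ^[n])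
    fun y hy y' hy' hne => (hsep y y' (hy.trans hy'.symm) hne).mono fun n hn => ?_
  rw [edist_nndist]
  exact_mod_cast hn

end SmaleSpace

namespace SUBijectivePair

variable {X Y Z : Type*} [MetricSpace X] [CompactSpace X] [MetricSpace Y]
  [CompactSpace Y] [MetricSpace Z] [CompactSpace Z]
  {SX : SmaleSpace X} {SY : SmaleSpace Y} {SZ : SmaleSpace Z} (π : SUBijectivePair SX SY SZ)

theorem exists_forall_encard_πs_fiber_le : ∃ N : ℕ, ∀ x, (π.πs ⁻¹' {x}).encard ≤ N :=
  SY.exists_forall_encard_fiber_le SX.isExpansive π.πs_continuous π.πs_map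
    fun y => (π.πs_bijOn y).injOn

variable {π} {L M : ℕ}

theorem exists_lt_coord_eq (w : π.Space L M)
    (h : (π.πs ⁻¹' {π.πu (w.1.2 0)}).encard ≤ L) :
    ∃ i j : Fin (L + 1), i < j ∧ w.1.1 i = w.1.1 j := by
  have hcard : (π.πs ⁻¹' {π.πu (w.1.2 0)}).encard < (univ : Set (Fin (L + 1))).encard := by
    rw [encard_univ, ENat.card_eq_coe_fintype_card, Fintype.card_fin]
    exact h.trans_lt (by exact_mod_cast L.lt_succ_self)
  obtain ⟨i, -, j, -, hne, hij⟩ :=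
    exists_ne_map_eq_of_encard_lt_of_maps_to hcard fun l _ => w.2 l 0
  rcases hne.lt_or_gt with hlt | hlt
  · exact ⟨i, j, hlt, hij⟩
  · exact ⟨j, i, hlt, hij.symm⟩

theorem coord_eq_of_mem_stableSet {e w : π.Space L M} (hw : w ∈ (π.sys L M).stableSet e)
    {i j : Fin (L + 1)} (hij : e.1.1 i = e.1.1 j) : w.1.1 i = w.1.1 j :=
  π.coord_eq (π.stablyEquiv_coord hw i) (π.stablyEquiv_coord hw j) hij

theorem reindex_eq_self {g : Fin (L + 1) → Fin (L + 1)} {w : π.Space L M}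
    (h : ∀ l, w.1.1 (g l) = w.1.1 l) : π.reindex M g w = w :=
  Subtype.ext (Prod.ext (funext h) rfl)

theorem reindex_insertNth_reindex_succAbove {l : Fin (L + 1)} {p : Fin (L + 2)}
    (hlp : l.castSucc < p) {w : π.Space (L + 1) M} (hw : w.1.1 l.castSucc = w.1.1 p) :
    π.reindex M (p.insertNth l id : Fin (L + 2) → Fin (L + 1)) (π.reindex M p.succAbove w) = w := by
  refine reindex_eq_self (g := p.succAbove ∘ (p.insertNth l id : Fin (L + 2) → Fin (L + 1)))
    ((Fin.forall_iff_succAbove p).2 ⟨?_, fun k => ?_⟩)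
  · simpa [Fin.succAbove_of_castSucc_lt _ _ hlp] using hw
  · simp

theorem exists_gen_eq_degMap (E : (π.sys (L + 1) M).CO) {e : π.Space (L + 1) M}
    (he : E.1 ⊆ (π.sys (L + 1) M).stableSet e) {l : Fin (L + 1)} {p : Fin (L + 2)}
    (hlp : l.castSucc < p) (hcoord : e.1.1 l.castSucc = e.1.1 p) :
    ∃ F : (π.sys L M).CO, (π.sys (L + 1) M).gen E = π.degMap L M l p ((π.sys L M).gen F) := by
  have hsection : LeftInvOn (π.reindex M (p.insertNth l id : Fin (L + 2) → Fin (L + 1)))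
      (π.reindex M p.succAbove) E.1 := fun w hw =>
    reindex_insertNth_reindex_succAbove hlp (coord_eq_of_mem_stableSet (he hw) hcoord)
  have hretract : Function.LeftInverse (π.reindex M p.succAbove)
      (π.reindex M (p.insertNth l id : Fin (L + 2) → Fin (L + 1))) := fun w =>
    reindex_eq_self (g := (p.insertNth l id : Fin (L + 2) → Fin (L + 1)) ∘ p.succAbove)
      fun k => by simp
  obtain ⟨F, hF⟩ : ∃ F : (π.sys L M).CO, F.1 = π.reindex M p.succAbove '' E.1 :=
    ⟨⟨_, E.2.image_of_leftInvOn (π.continuous_reindex _) (π.continuous_reindex _)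
      (fun _ _ => π.stablyEquiv_reindex _) hretract hsection⟩, rfl⟩
  refine ⟨F, ?_⟩
  rw [degMap, BracketSystem.StableMap.dsMap_gen]
  have himage : E.1 = π.reindex M (p.insertNth l id : Fin (L + 2) → Fin (L + 1)) '' F.1 := by
    rw [hF, hsection.image_image]
  exact congrArg _ (Subtype.ext himage)

theorem permMap_swap_gen (E : (π.sys L M).CO) {e : π.Space L M}
    (he : E.1 ⊆ (π.sys L M).stableSet e) {i j : Fin (L + 1)} (hij : e.1.1 i = e.1.1 j) :
    π.permMap L M (Equiv.swap i j) ((π.sys L M).gen E) = (π.sys L M).gen E := by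
  have hfix : ∀ w ∈ E.1, π.reindex M (Equiv.swap i j).symm w = w := fun w hw =>
    reindex_eq_self (Equiv.apply_swap_eq_self (coord_eq_of_mem_stableSet (he hw) hij))
  rw [permMap, BracketSystem.StableMap.dsMap_gen]
  exact congrArg _ (Subtype.ext ((image_congr hfix).trans (image_id' _)))

theorem exists_stableSet_coord_eq (h : ∀ x, (π.πs ⁻¹' {x}).encard ≤ L)
    (E : (π.sys L M).CO) :
    ∃ e : π.Space L M, E.1 ⊆ (π.sys L M).stableSet e ∧
      ∃ i j : Fin (L + 1), i < j ∧ e.1.1 i = e.1.1 j := by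
  obtain ⟨e, he⟩ := E.2.1
  exact ⟨e, he, exists_lt_coord_eq e (h _)⟩

theorem exists_lt_gen_eq_degMap (h : ∀ x, (π.πs ⁻¹' {x}).encard ≤ (L + 1 : ℕ))
    (E : (π.sys (L + 1) M).CO) :
    ∃ (l : Fin (L + 1)) (p : Fin (L + 2)), l.castSucc < p ∧ ∃ F : (π.sys L M).CO,
      (π.sys (L + 1) M).gen E = π.degMap L M l p ((π.sys L M).gen F) := by
  obtain ⟨e, he, i, p, hlt, hcoord⟩ := exists_stableSet_coord_eq h E
  obtain ⟨l, rfl⟩ := Fin.exists_castSucc_eq.2 (Fin.ne_last_of_lt hlt)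
  exact ⟨l, p, hlt, exists_gen_eq_degMap E he hlt hcoord⟩

theorem degImages_eq_top (h : ∀ x, (π.πs ⁻¹' {x}).encard ≤ L) : π.degImages L M = ⊤ := by
  refine BracketSystem.eq_top_of_forall_gen_mem _ fun E => ?_
  cases L with
  | zero =>
    obtain ⟨-, -, i, j, hlt, -⟩ := exists_stableSet_coord_eq h E
    exact absurd (Subsingleton.elim (α := Fin 1) i j) hlt.ne
  | succ L =>
    obtain ⟨l, p, hlp, F, hF⟩ := exists_lt_gen_eq_degMap h E
    rw [hF]
    exact AddSubgroup.mem_iSup_of_mem l (AddSubgroup.mem_iSup_of_mem p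
      (AddSubgroup.mem_iSup_of_mem hlp ⟨_, rfl⟩))

theorem DC_eq_top (h : ∀ x, (π.πs ⁻¹' {x}).encard ≤ L) : π.DC L M = ⊤ := by
  rw [DC, degImages_eq_top h, top_sup_eq]

theorem DB_eq_top (h : ∀ x, (π.πs ⁻¹' {x}).encard ≤ L) : π.DB L M = ⊤ := by
  refine BracketSystem.eq_top_of_forall_gen_mem _ fun E => ?_
  obtain ⟨e, he, i, j, hlt, hij⟩ := exists_stableSet_coord_eq h E
  exact AddSubgroup.subset_closure
    (Or.inl ⟨Equiv.swap i j, ⟨i, j, hlt.ne, rfl⟩, permMap_swap_gen E he hij⟩)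

end SUBijectivePair

theorem mainTheorem6_general {X Y Z : Type*} [MetricSpace X] [CompactSpace X] [MetricSpace Y]
    [CompactSpace Y] [MetricSpace Z] [CompactSpace Z]
    {SX : SmaleSpace X} {SY : SmaleSpace Y} {SZ : SmaleSpace Z}
    (π : SUBijectivePair SX SY SZ) :
    (∀ x : X, (π.πs ⁻¹' {x}).Finite) ∧
    ∃ K : ℕ, IsLUB (Set.range fun x : X => (π.πs ⁻¹' {x}).ncard) K ∧
      (∀ L M : ℕ, K ≤ L + 1 → ∀ E : (π.sys (L + 1) M).CO,
        ∃ (l : Fin (L + 1)) (p : Fin (L + 2)), l.castSucc < p ∧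
          ∃ F : (π.sys L M).CO,
            (π.sys (L + 1) M).gen E = π.degMap L M l p ((π.sys L M).gen F)) ∧
      (∀ L M : ℕ, K ≤ L → π.DC L M = ⊤) ∧
      (∀ L M : ℕ, K ≤ L → Subsingleton (π.CQ L M)) := by
  obtain ⟨N, hN⟩ := π.exists_forall_encard_πs_fiber_le
  have hfin x : (π.πs ⁻¹' {x}).Finite := finite_of_encard_le_coe (hN x)
  have hbdd : BddAbove (range fun x : X => (π.πs ⁻¹' {x}).ncard) :=
    ⟨N, forall_mem_range.2 fun x => (encard_le_coe_iff_finite_ncard_le.1 (hN x)).2⟩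
  obtain ⟨K, hK⟩ : ∃ K, IsLUB (range fun x : X => (π.πs ⁻¹' {x}).ncard) K :=
    ⟨_, isLUB_csSup' hbdd⟩
  have hle {L : ℕ} (hL : K ≤ L) x : (π.πs ⁻¹' {x}).encard ≤ L :=
    encard_le_coe_iff_finite_ncard_le.2 ⟨hfin x, (hK.1 (mem_range_self x)).trans hL⟩
  exact ⟨hfin, K, hK, fun L M hL => SUBijectivePair.exists_lt_gen_eq_degMap (hle hL),
    fun L M hL => SUBijectivePair.DC_eq_top (hle hL),
    fun L M hL => QuotientAddGroup.subsingleton_iff.2 (SUBijectivePair.DB_eq_top (hle hL))⟩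

theorem mainTheorem6 {X Y Z : Type*} [MetricSpace X] [CompactSpace X] [MetricSpace Y]
    [CompactSpace Y] [MetricSpace Z] [CompactSpace Z]
    (SX : SmaleSpace X) (SY : SmaleSpace Y) (SZ : SmaleSpace Z)
    (π : SUBijectivePair SX SY SZ)
    (hfin : ∀ x : X, (π.πs ⁻¹' {x}).Finite) :
    ∃ K : ℕ, IsLUB (Set.range fun x : X => (π.πs ⁻¹' {x}).ncard) K ∧
      (∀ L M : ℕ, K + 1 ≤ L + 1 → ∀ E : (π.sys (L + 1) M).CO,
        ∃ (l : Fin (L + 1)) (p : Fin (L + 2)), l.castSucc < p ∧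
          ∃ F : (π.sys L M).CO,
            (π.sys (L + 1) M).gen E = π.degMap L M l p ((π.sys L M).gen F)) ∧
      (∀ L M : ℕ, K + 1 ≤ L → π.DC L M = ⊤) ∧
      (∀ L M : ℕ, K + 1 ≤ L → Subsingleton (π.CQ L M)) := by
  obtain ⟨-, K, hK, hgen, hDC, hCQ⟩ := mainTheorem6_general π
  exact ⟨K, hK, fun L M hL => hgen L M (K.le_succ.trans hL),
    fun L M hL => hDC L M (K.le_succ.trans hL), fun L M hL => hCQ L M (K.le_succ.trans hL)⟩
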